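/- All spaces are Tychonoff. A set $C$ in a space $X$ is regularly closed if $C=\overline{\mathrm{Int}\,C}$. A quasi $\kappa$-metric on $X$ is a function $\rho$ assigning to each point $x\in X$ and each regularly closed set $C\subset X$ a real number $\rho(x,C)\ge 0$ such that (1) for every regularly closed $C$ there is a dense open subset $V$ of $X\setminus C$ such that, for all $x\in X$, $\rho(x,C)>0$ if and only if $x\in V$; (2) if $C\subset C'$ are regularly closed, then $\rho(x,C')\le\rho(x,C)$ for every $x\in X$; (3) for every regularly closed $C$ the function $x\mapsto\rho(x,C)$ is continuous on $X$; (4) $\rho\bigl(x,\overline{\bigcup_\alpha C_\alpha}\bigr)=\inf_\alpha\rho(x,C_\alpha)$ for every $x\in X$ and every non-empty increasing transfinite (that is, well-ordered) family $\{C_\alpha\}$ of regularly closed sets in $X$. It is regular if, moreover, (5) $\rho(x,C)\le\rho(x,C')+\sup\{\rho(y,C):y\in C'\}$ for every $x\in X$ and all regularly closed $C,C'\subset X$, where the supremum is taken in $[0,\infty]$ (so it is $0$ if $C'=\varnothing$). A space is (regularly) quasi $\kappa$-metrizable if it admits a (regular) quasi $\kappa$-metric. **Theorem.** Let $(X_i)_{i\in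 I}$ be an arbitrary family of Tychonoff spaces. If every $X_i$ is quasi $\kappa$-metrizable, then the product $\prod_{i\in I}X_i$ is quasi $\kappa$-metrizable. If every $X_i$ is regularly quasi $\kappa$-metrizable, then $\prod_{i\in I}X_i$ is regularly quasi $\kappa$-metrizable. -/

import Mathlib

open scoped NNReal ENNReal

universe u v

/-- A set is regularly closed if it is the closure of its interior. -/
def IsRegularlyClosed {X : Type u} [TopologicalSpace X] (C : Set X) : Prop :=
  closure (interior C) = C

/-- `ρ` is a quasi κ-metric on `X`: a non-negative real function `ρ x C` of a point `x` and a
regularly closed set `C` (the values of `ρ x` at other sets are irrelevant). -/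
structure IsQuasiKappaMetric {X : Type u} [TopologicalSpace X] (ρ : X → Set X → ℝ≥0) :
    Prop where
  /-- For each `C`, the set where `ρ · C` is positive is a dense open subset of `X \ C`. -/
  exists_dense_open : ∀ C : Set X, IsRegularlyClosed C →
    ∃ V : Set X, IsOpen V ∧ V ⊆ Cᶜ ∧ Cᶜ ⊆ closure V ∧ ∀ x : X, 0 < ρ x C ↔ x ∈ V
  /-- `ρ` is decreasing in the set variable. -/
  anti : ∀ C C' : Set X, IsRegularlyClosed C → IsRegularlyClosed C' → C ⊆ C' →
    ∀ x : X, ρ x C' ≤ ρ x C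
  /-- `ρ` is continuous in the point variable. -/
  continuous_left : ∀ C : Set X, IsRegularlyClosed C → Continuous fun x : X => ρ x C
  /-- Compatibility with increasing transfinite (i.e. well-ordered, non-empty) families. An index
  in the universe of `X` is no restriction, since the range of such a family is well-ordered. -/
  closure_iUnion : ∀ (κ : Type u) [LinearOrder κ] [WellFoundedLT κ] [Nonempty κ]
    (C : κ → Set X), (∀ a, IsRegularlyClosed (C a)) → Monotone C →
    ∀ x : X, ρ x (closure (⋃ a, C a)) = ⨅ a, ρ x (C a)

/-- `ρ` is a regular quasi κ-metric: moreover `ρ(x, C) ≤ ρ(x, C') + sup {ρ(y, C) : y ∈ C'}`.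
The supremum is taken in `[0, ∞]`, so that it is `∞` when unbounded and `0` when `C'` is empty. -/
structure IsRegularQuasiKappaMetric {X : Type u} [TopologicalSpace X] (ρ : X → Set X → ℝ≥0) :
    Prop extends IsQuasiKappaMetric ρ where
  le_add_iSup : ∀ C C' : Set X, IsRegularlyClosed C → IsRegularlyClosed C' → ∀ x : X,
    (ρ x C : ℝ≥0∞) ≤ (ρ x C' : ℝ≥0∞) + ⨆ y ∈ C', (ρ y C : ℝ≥0∞)

/-- A space is quasi κ-metrizable if it admits a quasi κ-metric. -/
def QuasiKappaMetrizable (X : Type u) [TopologicalSpace X] : Prop :=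
  ∃ ρ : X → Set X → ℝ≥0, IsQuasiKappaMetric ρ

/-- A space is regularly quasi κ-metrizable if it admits a regular quasi κ-metric. -/
def RegularlyQuasiKappaMetrizable (X : Type u) [TopologicalSpace X] : Prop :=
  ∃ ρ : X → Set X → ℝ≥0, IsRegularQuasiKappaMetric ρ

/-! On the product, `piKappa` measures the best finite box around `x` missing `C`: the complement of
a finite union of cylinders over regularly closed `D i` that covers `C`. The size of the box is the
least of the `ρ i (x i) (D i)`, capped by `1 / (card K + 1)`. The cap forces boxes of size at least
`v > 0` to have boundedly many active coordinates, which gives a compactness principle,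
`IsBoxBound.of_ultrafilter`: such boxes have a limit box along an ultrafilter. It yields both upper
semicontinuity in `x` and the chain condition. The sizes survive in the limit because the chain
condition in each factor upgrades to directed unions (`le_closure_sUnion`). Regularity is inherited
by replacing each `D i` with a neighbourhood given by a sublevel set of `ρ i · (D i)`. -/

theorem IsOpen.isRegularlyClosed_closure {X : Type u} [TopologicalSpace X] {U : Set X}
    (hU : IsOpen U) : IsRegularlyClosed (closure U) :=
  Set.Subset.antisymm (closure_minimal interior_subset isClosed_closure)
    (closure_mono (hU.subset_interior_iff.2 subset_closure))

namespace IsRegularlyClosed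

variable {X : Type u} [TopologicalSpace X]

theorem isClosed {C : Set X} (hC : IsRegularlyClosed C) : IsClosed C := by
  rw [← show closure (interior C) = C from hC]
  exact isClosed_closure

theorem nonempty_inter_interior {C G : Set X} (hC : IsRegularlyClosed C) (hG : IsOpen G)
    (h : (G ∩ C).Nonempty) : (G ∩ interior C).Nonempty := by
  obtain ⟨x, hxG, hxC⟩ := h
  rw [← show closure (interior C) = C from hC] at hxC
  exact mem_closure_iff.1 hxC G hG hxG

theorem closure_sUnion {𝓔 : Set (Set X)} (h : ∀ E ∈ 𝓔, IsRegularlyClosed E) :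
    IsRegularlyClosed (closure (⋃₀ 𝓔)) := by
  refine Set.Subset.antisymm (closure_minimal interior_subset isClosed_closure) ?_
  refine closure_minimal (Set.sUnion_subset fun E hE => ?_) isClosed_closure
  rw [← show closure (interior E) = E from h E hE]
  exact closure_mono (interior_mono ((Set.subset_sUnion_of_mem hE).trans subset_closure))

theorem closure_iUnion {κ : Type*} {C : κ → Set X} (h : ∀ a, IsRegularlyClosed (C a)) :
    IsRegularlyClosed (closure (⋃ a, C a)) := by
  rw [← Set.sUnion_range]
  exact closure_sUnion (Set.forall_mem_range.2 h)

theorem isClosed_sUnion {t : Set (Set X)} (ht : t.Finite) (h : ∀ E ∈ t, IsRegularlyClosed E) :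
    IsClosed (⋃₀ t) := by
  rw [Set.sUnion_eq_biUnion]
  exact ht.isClosed_biUnion fun E hE => (h E hE).isClosed

theorem sUnion_of_finite {t : Set (Set X)} (ht : t.Finite) (h : ∀ E ∈ t, IsRegularlyClosed E) :
    IsRegularlyClosed (⋃₀ t) := by
  simpa only [(isClosed_sUnion ht h).closure_eq] using closure_sUnion h

end IsRegularlyClosed

/-! ### Consequences of the axioms in one factor. -/

namespace IsQuasiKappaMetric

variable {X : Type u} [TopologicalSpace X] {ρ : X → Set X → ℝ≥0}

theorem notMem_of_pos (h : IsQuasiKappaMetric ρ) {C : Set X} (hC : IsRegularlyClosed C) {x : X}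
    (hx : 0 < ρ x C) : x ∉ C := by
  obtain ⟨V, -, hVC, -, hV⟩ := h.exists_dense_open C hC
  exact hVC ((hV x).1 hx)

theorem exists_pos (h : IsQuasiKappaMetric ρ) {C O : Set X} (hC : IsRegularlyClosed C)
    (hO : IsOpen O) (hne : O.Nonempty) (hd : O ⊆ Cᶜ) : ∃ x ∈ O, 0 < ρ x C := by
  obtain ⟨V, -, -, hVd, hV⟩ := h.exists_dense_open C hC
  obtain ⟨x, hx⟩ := hne
  obtain ⟨y, hyO, hyV⟩ := mem_closure_iff.1 (hVd (hd hx)) O hO hx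
  exact ⟨y, hyO, (hV y).2 hyV⟩

/-- The chain condition implies the corresponding condition for directed unions. -/
theorem le_closure_sUnion (h : IsQuasiKappaMetric ρ) {x : X} {ε : ℝ≥0} (𝓔 : Set (Set X))
    (hreg : ∀ E ∈ 𝓔, IsRegularlyClosed E)
    (hfin : ∀ t : Set (Set X), t.Finite → t ⊆ 𝓔 → ε ≤ ρ x (⋃₀ t)) :
    ε ≤ ρ x (closure (⋃₀ 𝓔)) := by
  induction hc : Cardinal.mk 𝓔 using WellFoundedLT.induction generalizing 𝓔 with
  | ind c ih =>
  subst hc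
  rcases 𝓔.finite_or_infinite with hf | hinf
  · rw [(IsRegularlyClosed.isClosed_sUnion hf hreg).closure_eq]
    exact hfin 𝓔 hf subset_rfl
  have hinf' : Cardinal.aleph0 ≤ Cardinal.mk 𝓔 := by
    have := hinf.to_subtype
    exact Cardinal.aleph0_le_mk 𝓔
  have : NoMaxOrder (Cardinal.mk 𝓔).ord.ToType := Cardinal.noMaxOrder hinf'
  obtain ⟨e⟩ : Nonempty ((Cardinal.mk 𝓔).ord.ToType ≃ 𝓔) := by
    rw [← Cardinal.eq]
    exact Cardinal.mk_ord_toType _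
  have : Nonempty (Cardinal.mk 𝓔).ord.ToType := by
    obtain ⟨E, hE⟩ := hinf.nonempty
    exact ⟨e.symm ⟨E, hE⟩⟩
  -- Enumerating along the initial ordinal gives every initial segment smaller cardinality, so the
  -- induction hypothesis applies to each member of the chain.
  let T : (Cardinal.mk 𝓔).ord.ToType → Set (Set X) := fun i => (fun j => (e j : Set X)) '' Set.Iic i
  have hT𝓔 : ∀ i, T i ⊆ 𝓔 := by
    rintro i _ ⟨j, -, rfl⟩
    exact (e j).2
  have hTmono : Monotone T := fun i j hij => Set.image_mono (Set.Iic_subset_Iic.2 hij)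
  have hTreg : ∀ i, IsRegularlyClosed (closure (⋃₀ T i)) := fun i =>
    IsRegularlyClosed.closure_sUnion fun E hE => hreg E (hT𝓔 i hE)
  have hTcard : ∀ i, Cardinal.mk (T i) < Cardinal.mk 𝓔 := by
    intro i
    obtain ⟨j, hij⟩ := exists_gt i
    refine Cardinal.mk_image_le.trans_lt ?_
    refine (Cardinal.mk_le_mk_of_subset (Set.Iic_subset_Iio.2 hij)).trans_lt ?_
    exact (Cardinal.mk_Iio_lt j (by simp)).trans_eq (Cardinal.mk_ord_toType _)
  have hunion : closure (⋃₀ 𝓔) = closure (⋃ i, closure (⋃₀ T i)) := by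
    refine Set.Subset.antisymm (closure_mono ?_) (closure_minimal ?_ isClosed_closure)
    · intro y ⟨E, hE, hy⟩
      refine Set.mem_iUnion.2 ⟨e.symm ⟨E, hE⟩, subset_closure ⟨E, ?_, hy⟩⟩
      exact ⟨e.symm ⟨E, hE⟩, Set.mem_Iic.2 le_rfl, by simp⟩
    · exact Set.iUnion_subset fun i => closure_mono (Set.sUnion_mono (hT𝓔 i))
  rw [hunion, h.closure_iUnion _ _ hTreg
    fun i j hij => closure_mono (Set.sUnion_mono (hTmono hij))]
  exact le_ciInf fun i => ih _ (hTcard i) (T i) (fun E hE => hreg E (hT𝓔 i hE))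
    (fun t ht htT => hfin t ht (htT.trans (hT𝓔 i))) rfl

end IsQuasiKappaMetric

/-! ### The quasi κ-metric on the product. -/

section Product

variable {ι : Type v} {X : ι → Type u} [∀ i, TopologicalSpace (X i)]

/-- `v` is a lower bound for the size, as seen from `x`, of some standard open box with finite
support that misses `C`. -/
def IsBoxBound (ρ : ∀ i, X i → Set (X i) → ℝ≥0) (x : ∀ i, X i) (C : Set (∀ i, X i))
    (v : ℝ≥0) : Prop :=
  ∃ (K : Finset ι) (D : ∀ i, Set (X i)), (∀ i ∈ K, IsRegularlyClosed (D i)) ∧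
    (∀ y ∈ C, ∃ i ∈ K, y i ∈ D i) ∧ v ≤ ((K.card : ℝ≥0) + 1)⁻¹ ∧ ∀ i ∈ K, v ≤ ρ i (x i) (D i)

/-- The size, as seen from `x`, of the largest standard open box that misses `C`. -/
noncomputable def piKappa (ρ : ∀ i, X i → Set (X i) → ℝ≥0) (x : ∀ i, X i)
    (C : Set (∀ i, X i)) : ℝ≥0 :=
  sSup {v | IsBoxBound ρ x C v}

variable {ρ : ∀ i, X i → Set (X i) → ℝ≥0} {x : ∀ i, X i} {C C' : Set (∀ i, X i)} {v w : ℝ≥0}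

theorem IsBoxBound.mono (h : IsBoxBound ρ x C v) (hw : w ≤ v) (hC : C' ⊆ C) :
    IsBoxBound ρ x C' w := by
  obtain ⟨K, D, hD, hcov, hK, hv⟩ := h
  exact ⟨K, D, hD, fun y hy => hcov y (hC hy), hw.trans hK, fun i hi => hw.trans (hv i hi)⟩

theorem bddAbove_isBoxBound : BddAbove {v | IsBoxBound ρ x C v} := by
  refine ⟨1, ?_⟩
  rintro v ⟨K, D, -, -, hK, -⟩
  exact hK.trans (inv_le_one_of_one_le₀ (by simp))

theorem IsBoxBound.le_piKappa (h : IsBoxBound ρ x C v) : v ≤ piKappa ρ x C :=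
  le_csSup bddAbove_isBoxBound h

theorem IsBoxBound.of_lt_piKappa (h : v < piKappa ρ x C) : IsBoxBound ρ x C v := by
  obtain ⟨w, hw, hvw⟩ := exists_lt_of_lt_csSup' h
  exact IsBoxBound.mono hw hvw.le subset_rfl

/-- The limit of boxes along an ultrafilter. -/
theorem IsBoxBound.of_ultrafilter (hρ : ∀ i, IsQuasiKappaMetric (ρ i)) {α : Type*}
    (𝒰 : Ultrafilter α) {ξ : α → ∀ i, X i} (hξ : Filter.Tendsto ξ 𝒰 (nhds x))
    {F : α → Set (∀ i, X i)}
    (hF : ∀ G : Set (∀ i, X i), IsOpen G → (G ∩ C).Nonempty →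
      ∃ P : Set (∀ i, X i), IsOpen P ∧ P.Nonempty ∧ P ⊆ G ∧ ∀ᶠ a in 𝒰, P ⊆ F a)
    (hv : 0 < v) (h : ∀ᶠ a in 𝒰, IsBoxBound ρ (ξ a) (F a) v) : IsBoxBound ρ x C v := by
  classical
  have hchoose : ∀ a, ∃ (K : Finset ι) (D : ∀ i, Set (X i)), IsBoxBound ρ (ξ a) (F a) v →
      (∀ i ∈ K, IsRegularlyClosed (D i)) ∧ (∀ y ∈ F a, ∃ i ∈ K, y i ∈ D i) ∧
      v ≤ ((K.card : ℝ≥0) + 1)⁻¹ ∧ ∀ i ∈ K, v ≤ ρ i (ξ a i) (D i) := by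
    intro a
    by_cases ha : IsBoxBound ρ (ξ a) (F a) v
    · obtain ⟨K, D, hKD⟩ := ha
      exact ⟨K, D, fun _ => hKD⟩
    · exact ⟨∅, fun _ => ∅, fun h => absurd h ha⟩
  choose K D hKD using hchoose
  have hev := h.mono hKD
  have hcard : ∀ t : Finset ι, (∀ i ∈ t, ∀ᶠ a in 𝒰, i ∈ K a) → v ≤ ((t.card : ℝ≥0) + 1)⁻¹ := by
    intro t ht
    obtain ⟨a, hta, -, -, hva, -⟩ := (((Filter.eventually_all_finset t).2 ht).and hev).exists
    refine hva.trans ?_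
    have : t.card ≤ (K a).card := Finset.card_le_card hta
    gcongr
  -- Any finite set of such coordinates lies in a single `K a`, so the cap bounds its size in terms
  -- of `v⁻¹`.
  have hLfin : {i | ∀ᶠ a in 𝒰, i ∈ K a}.Finite := by
    by_contra hinf
    obtain ⟨n, hn⟩ := exists_nat_gt v⁻¹
    obtain ⟨t, htL, htn⟩ := Set.Infinite.exists_subset_card_eq hinf n
    have h1 := hcard t fun i hi => htL hi
    rw [htn, le_inv_comm₀ hv (by positivity)] at h1
    exact absurd (h1.trans_lt hn) (by simp)
  have hLmem : ∀ i, i ∈ hLfin.toFinset ↔ ∀ᶠ a in 𝒰, i ∈ K a := fun i => by simp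
  -- The limit of the `D a i` is the closure of the union of the regularly closed sets eventually
  -- inside them.
  let 𝓔 : ∀ i, Set (Set (X i)) := fun i => {E | IsRegularlyClosed E ∧ ∀ᶠ a in 𝒰, E ⊆ D a i}
  have h𝓔 : ∀ i, ∀ E ∈ 𝓔 i, IsRegularlyClosed E := fun i E hE => hE.1
  refine ⟨hLfin.toFinset, fun i => closure (⋃₀ 𝓔 i),
    fun i _ => IsRegularlyClosed.closure_sUnion (h𝓔 i), ?_,
    hcard _ fun i hi => (hLmem i).1 hi, ?_⟩
  · intro y hy
    by_contra! hcon
    let G : Set (∀ i, X i) := {z | ∀ i ∈ hLfin.toFinset, z i ∉ closure (⋃₀ 𝓔 i)}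
    have hG : IsOpen G := by
      have : G = ⋂ i ∈ hLfin.toFinset, (fun z : ∀ i, X i => z i) ⁻¹' (closure (⋃₀ 𝓔 i))ᶜ := by
        ext z
        simp [G]
      rw [this]
      exact isOpen_biInter_finset fun i _ =>
        isClosed_closure.isOpen_compl.preimage (continuous_apply i)
    obtain ⟨P, hP, ⟨p, hp⟩, hPG, hPF⟩ := hF G hG ⟨y, hcon, hy⟩
    obtain ⟨M, O, hO, hMO⟩ := isOpen_pi_iff.1 hP p hp
    have hbox : ∀ z : ∀ i, X i, (∀ i ∈ M, z i ∈ O i) → z ∈ P := fun z hz =>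
      hMO fun i hi => hz i hi
    -- Otherwise, the filter being ultra, `closure (O i)` belongs to `𝓔 i`, which puts `p i` in the
    -- limit set although `p ∈ G`.
    have hM : ∀ i ∈ M, ∀ᶠ a in 𝒰, i ∈ K a → ∃ z ∈ O i, z ∉ D a i := by
      intro i hi
      by_cases hiL : i ∈ hLfin.toFinset
      · by_contra hne
        have hsub : ∀ᶠ a in 𝒰, i ∈ K a ∧ O i ⊆ D a i := by
          refine (Ultrafilter.eventually_not.2 hne).mono fun a ha => ?_
          push Not at ha
          exact ha
        have hcl : closure (O i) ∈ 𝓔 i := by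
          refine ⟨(hO i hi).1.isRegularlyClosed_closure, ?_⟩
          filter_upwards [hsub, hev] with a ha hDa
          exact closure_minimal ha.2 (hDa.1 i ha.1).isClosed
        exact hPG hp i hiL
          (subset_closure ⟨_, hcl, subset_closure (hO i hi).2⟩)
      · rw [hLmem] at hiL
        filter_upwards [Ultrafilter.eventually_not.2 hiL] with a ha ha'
        exact absurd ha' ha
    obtain ⟨a, ⟨hDa, hcov, -, hva⟩, hPa, hMa⟩ :=
      (hev.and (hPF.and ((Filter.eventually_all_finset M).2 hM))).exists
    have hz : ∀ i, ∃ z : X i, (i ∈ M → z ∈ O i) ∧ (i ∈ K a → z ∉ D a i) := by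
      intro i
      by_cases hiM : i ∈ M
      · by_cases hiK : i ∈ K a
        · obtain ⟨z, hzO, hzD⟩ := hMa i hiM hiK
          exact ⟨z, fun _ => hzO, fun _ => hzD⟩
        · exact ⟨p i, fun _ => (hO i hiM).2, fun h => absurd h hiK⟩
      -- Coordinates outside `M` are unconstrained by `P`; there `ξ a i` avoids `D a i` because `v >
      -- 0`.
      · exact ⟨ξ a i, fun h => absurd h hiM, fun hiK =>
          (hρ i).notMem_of_pos (hDa i hiK) (hv.trans_le (hva i hiK))⟩
    choose z hzO hzD using hz
    obtain ⟨i, hiK, hzi⟩ := hcov z (hPa (hbox z hzO))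
    exact hzD i hiK hzi
  · intro i hi
    refine (hρ i).le_closure_sUnion _ (h𝓔 i) fun t ht ht𝓔 => ?_
    have htreg := IsRegularlyClosed.sUnion_of_finite ht fun E hE => h𝓔 i E (ht𝓔 hE)
    have hcont : Filter.Tendsto (fun a => ρ i (ξ a i) (⋃₀ t)) 𝒰 (nhds (ρ i (x i) (⋃₀ t))) :=
      (((hρ i).continuous_left _ htreg).tendsto _).comp (((continuous_apply i).tendsto x).comp hξ)
    refine ge_of_tendsto hcont ?_
    have hsub : ∀ᶠ a in 𝒰, ∀ E ∈ t, E ⊆ D a i :=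
      (Filter.eventually_all_finite ht).2 fun E hE => (ht𝓔 hE).2
    filter_upwards [hsub, hev, (hLmem i).1 hi] with a hta ⟨hDa, _, _, hva⟩ hia
    exact (hva i hia).trans ((hρ i).anti _ _ htreg (hDa i hia) (Set.sUnion_subset hta) _)

/-- A fixed box keeps almost its size under small moves of `x`, giving lower semicontinuity. If
upper semicontinuity failed, boxes along an ultrafilter converging to `x` would have too large a
limit. -/
theorem continuous_piKappa (hρ : ∀ i, IsQuasiKappaMetric (ρ i)) (hC : IsRegularlyClosed C) :
    Continuous fun x => piKappa ρ x C := by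
  refine continuous_iff_continuousAt.2 fun x => tendsto_order.2 ⟨fun b hb => ?_, fun b hb => ?_⟩
  · obtain ⟨b', hbb', hb'⟩ := exists_between hb
    obtain ⟨b'', hb'b'', hb''⟩ := exists_between hb'
    obtain ⟨K, D, hD, hcov, hK, hKv⟩ := IsBoxBound.of_lt_piKappa hb''
    have hev : ∀ i ∈ K, ∀ᶠ y in nhds x, b' < ρ i (y i) (D i) := fun i hi =>
      (((hρ i).continuous_left _ (hD i hi)).comp (continuous_apply i)).continuousAt.eventually
        (lt_mem_nhds (hb'b''.trans_le (hKv i hi)))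
    filter_upwards [(Filter.eventually_all_finset K).2 hev] with y hy
    refine hbb'.trans_le (IsBoxBound.le_piKappa
      ⟨K, D, hD, hcov, hb'b''.le.trans hK, fun i hi => (hy i hi).le⟩)
  · by_contra hne
    have hne' : (nhds x ⊓ Filter.principal {y | ¬piKappa ρ y C < b}).NeBot :=
      Filter.frequently_mem_iff_neBot.1 (Filter.not_eventually.1 hne)
    obtain ⟨𝒰, h𝒰'⟩ := Ultrafilter.exists_le (nhds x ⊓ Filter.principal {y | ¬piKappa ρ y C < b})
    have h𝒰 : (𝒰 : Filter _) ≤ nhds x := h𝒰'.trans inf_le_left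
    have hle : ∀ᶠ y in 𝒰, ¬piKappa ρ y C < b := Filter.le_principal_iff.1 (h𝒰'.trans inf_le_right)
    obtain ⟨c, hc, hcb⟩ := exists_between hb
    refine hc.not_ge (IsBoxBound.le_piKappa (IsBoxBound.of_ultrafilter hρ 𝒰 (ξ := id)
      (F := fun _ => C) h𝒰 (fun G hG hGC => ?_) (zero_le.trans_lt hc) ?_))
    · exact ⟨G ∩ interior C, hG.inter isOpen_interior, hC.nonempty_inter_interior hG hGC,
        Set.inter_subset_left, .of_forall fun _ => Set.inter_subset_right.trans interior_subset⟩
    · exact hle.mono fun y hy => .of_lt_piKappa (hcb.trans_le (not_lt.1 hy))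

theorem exists_piKappa_pos (hρ : ∀ i, IsQuasiKappaMetric (ρ i)) (hC : IsRegularlyClosed C)
    {G : Set (∀ i, X i)} (hG : IsOpen G) (hGC : G ⊆ Cᶜ) (hne : G.Nonempty) :
    ∃ y ∈ G, 0 < piKappa ρ y C := by
  classical
  obtain ⟨x, hx⟩ := hne
  obtain ⟨M, O, hO, hMO⟩ := isOpen_pi_iff.1 hG x hx
  -- The complement of `D i` is the interior of `closure (O i)`: a point of `C` in the box of these
  -- complements would make `interior C` meet the box of the `O i`.
  let D : ∀ i, Set (X i) := fun i => closure (closure (O i))ᶜ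
  have hD : ∀ i, IsRegularlyClosed (D i) := fun i =>
    isClosed_closure.isOpen_compl.isRegularlyClosed_closure
  have hcov : ∀ y ∈ C, ∃ i ∈ M, y i ∈ D i := by
    intro y hy
    by_contra! hcon
    have hW : IsOpen ((M : Set ι).pi fun i => (D i)ᶜ) :=
      isOpen_set_pi M.finite_toSet fun i _ => isClosed_closure.isOpen_compl
    obtain ⟨z, hzW, hzC⟩ := hC.nonempty_inter_interior hW ⟨y, fun i hi => hcon i hi, hy⟩
    have hzcl : z ∈ closure ((M : Set ι).pi O) := by
      rw [closure_pi_set]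
      intro i hi
      by_contra hzi
      exact hzW i hi (subset_closure hzi)
    obtain ⟨z', hz'C, hz'O⟩ := mem_closure_iff.1 hzcl _ isOpen_interior hzC
    exact hGC (hMO hz'O) (interior_subset hz'C)
  have hpos : ∀ i ∈ M, ∃ y ∈ O i, 0 < ρ i y (D i) := fun i hi =>
    (hρ i).exists_pos (hD i) (hO i hi).1 ⟨_, (hO i hi).2⟩ <| by
      rw [Set.subset_compl_comm]
      exact closure_minimal (Set.compl_subset_compl.2 subset_closure) (hO i hi).1.isClosed_compl
  have hy : ∀ i, ∃ y : X i, i ∈ M → y ∈ O i ∧ 0 < ρ i y (D i) := by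
    intro i
    by_cases hi : i ∈ M
    · obtain ⟨y, hy⟩ := hpos i hi
      exact ⟨y, fun _ => hy⟩
    · exact ⟨x i, fun h => absurd h hi⟩
  choose y hy using hy
  obtain ⟨v, hv0, hv⟩ : ∃ v : ℝ≥0, 0 < v ∧ ∀ i ∈ M, v ≤ ρ i (y i) (D i) := by
    rcases M.eq_empty_or_nonempty with rfl | hMne
    · exact ⟨1, one_pos, by simp⟩
    · obtain ⟨i, hi, hmin⟩ := M.exists_min_image (fun i => ρ i (y i) (D i)) hMne
      exact ⟨_, (hy i hi).2, hmin⟩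
  refine ⟨y, hMO fun i hi => (hy i hi).1, (?_ : 0 < min v ((M.card : ℝ≥0) + 1)⁻¹).trans_le
    (IsBoxBound.le_piKappa ⟨M, D, fun i _ => hD i, hcov, min_le_right _ _,
      fun i hi => (min_le_left _ _).trans (hv i hi)⟩)⟩
  exact lt_min hv0 (by positivity)

theorem isQuasiKappaMetric_piKappa (hρ : ∀ i, IsQuasiKappaMetric (ρ i)) :
    IsQuasiKappaMetric (piKappa ρ) where
  exists_dense_open C hC := by
    refine ⟨{x | 0 < piKappa ρ x C}, isOpen_lt continuous_const (continuous_piKappa hρ hC), ?_, ?_,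
      fun _ => Iff.rfl⟩
    · intro x hx hxC
      obtain ⟨v, hv0, hv⟩ := exists_between (show 0 < piKappa ρ x C from hx)
      obtain ⟨K, D, hD, hcov, -, hKv⟩ := IsBoxBound.of_lt_piKappa hv
      obtain ⟨i, hi, hxi⟩ := hcov x hxC
      exact (hρ i).notMem_of_pos (hD i hi) (hv0.trans_le (hKv i hi)) hxi
    · intro x hx
      refine mem_closure_iff.2 fun G hG hxG => ?_
      obtain ⟨y, hy, hpos⟩ := exists_piKappa_pos hρ hC (hG.inter hC.isClosed.isOpen_compl)
        Set.inter_subset_right ⟨x, hxG, hx⟩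
      exact ⟨y, hy.1, hpos⟩
  anti C C' _ _ hCC' x := le_of_forall_lt fun v hv =>
    let ⟨_, hvw, hw⟩ := exists_between hv
    hvw.trans_le ((IsBoxBound.of_lt_piKappa hw).mono le_rfl hCC').le_piKappa
  continuous_left C hC := continuous_piKappa hρ hC
  closure_iUnion κ _ _ _ C hC hmono x := by
    have hanti : ∀ a, piKappa ρ x (closure (⋃ a, C a)) ≤ piKappa ρ x (C a) := fun a =>
      le_of_forall_lt fun v hv =>
        let ⟨_, hvw, hw⟩ := exists_between hv
        hvw.trans_le ((IsBoxBound.of_lt_piKappa hw).mono le_rfl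
          ((Set.subset_iUnion C a).trans subset_closure)).le_piKappa
    refine le_antisymm (le_ciInf hanti) (le_of_forall_lt fun c hc => ?_)
    obtain ⟨v, hcv, hv⟩ := exists_between hc
    refine hcv.trans_le (IsBoxBound.le_piKappa (IsBoxBound.of_ultrafilter hρ
      (Ultrafilter.of Filter.atTop) (ξ := fun _ => x) (F := C) tendsto_const_nhds
      (fun G hG hGC => ?_) (zero_le.trans_lt hcv) (.of_forall fun a =>
        .of_lt_piKappa (hv.trans_le (ciInf_le' _ a)))))
    obtain ⟨y, hyG, hy⟩ := hGC
    obtain ⟨z, hzG, hz⟩ := mem_closure_iff.1 hy G hG hyG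
    obtain ⟨a, hza⟩ := Set.mem_iUnion.1 hz
    refine ⟨G ∩ interior (C a), hG.inter isOpen_interior,
      (hC a).nonempty_inter_interior hG ⟨z, hzG, hza⟩, Set.inter_subset_left, ?_⟩
    exact Ultrafilter.of_le _ <| (Filter.eventually_ge_atTop a).mono fun b hab =>
      Set.inter_subset_right.trans (interior_subset.trans (hmono hab))

theorem piKappa_le_add {s : ℝ≥0} (hρ : ∀ i, IsRegularQuasiKappaMetric (ρ i))
    (hs : ∀ y ∈ C', piKappa ρ y C ≤ s) : piKappa ρ x C ≤ piKappa ρ x C' + s := by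
  refine le_of_forall_lt fun c hc => ?_
  obtain ⟨w, hcw, hw⟩ := exists_between hc
  rcases le_or_gt w s with hws | hsw
  · exact hcw.trans_le (hws.trans le_add_self)
  obtain ⟨v, hwv, hv⟩ := exists_between hw
  obtain ⟨K, D, hD, hcov, hK, hKv⟩ := IsBoxBound.of_lt_piKappa hv
  obtain ⟨δ, rfl⟩ := exists_add_of_le hwv.le
  have hδ : 0 < δ := by simpa using hwv
  have hsδ : s + δ ≤ w + δ := by gcongr
  -- A point of `C'` outside all `closure (O i)` would see a box of size `s + δ > s` missing `C`.
  -- The positive slack `δ` makes this a contradiction and cancels in the final estimate.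
  let O : ∀ i, Set (X i) := fun i => {z | ρ i z (D i) < s + δ}
  have hO : ∀ i ∈ K, IsOpen (O i) := fun i hi =>
    isOpen_lt ((hρ i).continuous_left _ (hD i hi)) continuous_const
  have hO' : ∀ i ∈ K, IsRegularlyClosed (closure (O i)) := fun i hi =>
    (hO i hi).isRegularlyClosed_closure
  have hle : ∀ i ∈ K, ∀ z ∈ closure (O i), ρ i z (D i) ≤ s + δ := fun i hi =>
    closure_minimal (t := {z | ρ i z (D i) ≤ s + δ}) (fun z (hz : ρ i z (D i) < s + δ) => hz.le)
      (isClosed_le ((hρ i).continuous_left _ (hD i hi)) continuous_const)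
  have hbound : IsBoxBound ρ x C' (w - s) := by
    refine ⟨K, fun i => closure (O i), hO', fun y hy => ?_,
      tsub_le_self.trans (hwv.le.trans hK), fun i hi => ?_⟩
    · by_contra! hcon
      have hy' : IsBoxBound ρ y C (s + δ) := ⟨K, D, hD, hcov, hsδ.trans hK, fun i hi =>
        not_lt.1 fun hlt => hcon i hi (subset_closure hlt)⟩
      exact (lt_add_of_pos_right s hδ).not_ge (hy'.le_piKappa.trans (hs y hy))
    · have h1 := (hρ i).le_add_iSup _ _ (hD i hi) (hO' i hi) (x i)
      have h2 : ⨆ z ∈ closure (O i), (ρ i z (D i) : ℝ≥0∞) ≤ ((s + δ : ℝ≥0) : ℝ≥0∞) :=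
        iSup₂_le fun z hz => ENNReal.coe_le_coe.2 (hle i hi z hz)
      have h3 := h1.trans (add_le_add_right h2 _)
      rw [← ENNReal.coe_add, ENNReal.coe_le_coe, ← add_assoc] at h3
      exact tsub_le_iff_right.2 (le_of_add_le_add_right ((hKv i hi).trans h3))
  exact hcw.trans_le (tsub_le_iff_right.1 hbound.le_piKappa)

theorem isRegularQuasiKappaMetric_piKappa (hρ : ∀ i, IsRegularQuasiKappaMetric (ρ i)) :
    IsRegularQuasiKappaMetric (piKappa ρ) where
  toIsQuasiKappaMetric := isQuasiKappaMetric_piKappa fun i => (hρ i).toIsQuasiKappaMetric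
  le_add_iSup C C' _ _ x := by
    rcases eq_or_ne (⨆ y ∈ C', (piKappa ρ y C : ℝ≥0∞)) ⊤ with htop | htop
    · simp [htop]
    lift (⨆ y ∈ C', (piKappa ρ y C : ℝ≥0∞)) to ℝ≥0 using htop with s hs
    rw [← ENNReal.coe_add, ENNReal.coe_le_coe]
    refine piKappa_le_add hρ fun y hy => ?_
    rw [← ENNReal.coe_le_coe, hs]
    exact le_iSup₂ (f := fun y (_ : y ∈ C') => (piKappa ρ y C : ℝ≥0∞)) y hy

end Product

theorem theorem2p5 {ι : Type v} (X : ι → Type u) [∀ i, TopologicalSpace (X i)]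
    [∀ i, T35Space (X i)] :
    ((∀ i, QuasiKappaMetrizable (X i)) → QuasiKappaMetrizable (∀ i, X i)) ∧
    ((∀ i, RegularlyQuasiKappaMetrizable (X i)) →
      RegularlyQuasiKappaMetrizable (∀ i, X i)) := by
  refine ⟨fun h => ?_, fun h => ?_⟩
  · choose ρ hρ using h
    exact ⟨piKappa ρ, isQuasiKappaMetric_piKappa hρ⟩
  · choose ρ hρ using h
    exact ⟨piKappa ρ, isRegularQuasiKappaMetric_piKappa hρ⟩
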